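/- For a double-indexed array of nonnegative real numbers $a(n,k)$ ($0\le k\le n$) with positive row sums, put $$p(n,k)=\frac{a(n,k)}{\sum_{j=0}^n a(n,j)}\quad(0\le k\le n),\qquad p(n,k)=0\ \text{ for all other integers } k,$$ and let $\mu_n=\sum_{k=0}^n k\,p(n,k)$ and $\sigma_n^2=\sum_{k=0}^n (k-\mu_n)^2p(n,k)$, with $\sigma_n\ge 0$, be the mean and variance of the $n$-th row. The array is called asymptotically normal by a central limit theorem if $$\lim_{n\to\infty}\sup_{x\in\mathbb R}\left|\sum_{k\le \mu_n+x\sigma_n}p(n,k)-\frac1{\sqrt{2\pi}}\int_{-\infty}^x e^{-t^2/2}\,dt\right|=0,$$ and asymptotically normal by a local limit theorem on $\mathbb R$ if $$\lim_{n\to\infty}\sup_{x\in\mathbb R}\left|\sigma_n\,p(n,\lfloor\mu_n+x\sigma_n\rfloor)-\frac1{\sqrt{2\pi}}e^{-x^2/2}\right|=0.$$ 1. Let $a(n,k)$ ($0\le k\le n$) be nonnegative real numbers such that, for every $n\ge 0$, the polynomial $A_n(x)=\sum_{k=0}^n a(n,k)x^k$ has degree exactly $n$ (that is, $a(n,n)\neq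 0$) and only real zeros. If there are two positive numbers $t_0,t_1$ such that the zeros of all $A_n(x)$ lie in the open interval $(-t_1,-t_0)$, then the array $a(n,k)$ is asymptotically normal both by a central limit theorem and by a local limit theorem on $\mathbb R$. 2. For $n\ge 0$ and $k\ge 0$ let $S(n,k)=\#\{(x_1,\dots,x_k)\in\mathbb Z^k: |x_1|+\cdots+|x_k|=n\}$ be the coordination numbers of the cubic lattices, and let $c(n,k)=S(n-k,k+1)$ for $0\le k\le n$. Then the array $c(n,k)$ is asymptotically normal both by a central limit theorem and by a local limit theorem on $\mathbb R$. -/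

import Mathlib

open Filter Topology MeasureTheory

noncomputable section

/-- The row polynomial `A_n(x) = ∑_{k=0}^n a(n,k) x^k` of a triangular array. -/
def rowPoly (a : ℕ → ℕ → ℝ) (n : ℕ) : Polynomial ℝ :=
  ∑ k ∈ Finset.range (n + 1), Polynomial.C (a n k) * Polynomial.X ^ k

/-- A real polynomial all of whose complex zeros are real. -/
def OnlyRealZeros (p : Polynomial ℝ) : Prop :=
  ∀ z : ℂ, Polynomial.aeval z p = 0 → z.im = 0

/-- The normalized probability `p(n,k) = a(n,k) / ∑_{j=0}^n a(n,j)` for `0 ≤ k ≤ n`,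
and `0` for every other integer `k`. -/
def normProb (a : ℕ → ℕ → ℝ) (n : ℕ) (k : ℤ) : ℝ :=
  if 0 ≤ k ∧ k ≤ (n : ℤ) then a n k.toNat / ∑ j ∈ Finset.range (n + 1), a n j else 0

/-- The mean `μ_n` of the `n`-th row. -/
def rowMean (a : ℕ → ℕ → ℝ) (n : ℕ) : ℝ :=
  ∑ k ∈ Finset.range (n + 1), (k : ℝ) * normProb a n k

/-- The variance `σ_n²` of the `n`-th row. -/
def rowVariance (a : ℕ → ℕ → ℝ) (n : ℕ) : ℝ :=
  ∑ k ∈ Finset.range (n + 1), ((k : ℝ) - rowMean a n) ^ 2 * normProb a n k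

/-- The standard deviation `σ_n` of the `n`-th row. -/
def rowStdDev (a : ℕ → ℕ → ℝ) (n : ℕ) : ℝ := √(rowVariance a n)

open Classical in
/-- Asymptotic normality by a central limit theorem. The supremum over `x` is taken in
`[0, ∞]`, so that it is a genuine supremum. -/
def AsympNormalCLT (a : ℕ → ℕ → ℝ) : Prop :=
  Tendsto (fun n : ℕ => ⨆ x : ℝ, ENNReal.ofReal
    |(∑ k ∈ (Finset.range (n + 1)).filter
          (fun k : ℕ => (k : ℝ) ≤ rowMean a n + x * rowStdDev a n), normProb a n k)
      - 1 / √(2 * Real.pi) * ∫ t in Set.Iic x, Real.exp (-t ^ 2 / 2)|)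
    atTop (𝓝 0)

/-- Asymptotic normality by a local limit theorem on `ℝ`. -/
def AsympNormalLLT (a : ℕ → ℕ → ℝ) : Prop :=
  Tendsto (fun n : ℕ => ⨆ x : ℝ, ENNReal.ofReal
    |rowStdDev a n * normProb a n ⌊rowMean a n + x * rowStdDev a n⌋
      - 1 / √(2 * Real.pi) * Real.exp (-x ^ 2 / 2)|)
    atTop (𝓝 0)

/-- The number `S(n,k)` of points of the cubic lattice `ℤ^k` at graph distance `n` from the
origin, that is, of `(x_1, …, x_k)` with `|x_1| + ⋯ + |x_k| = n`. -/
def latticeCoord (n k : ℕ) : ℕ :=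
  {x : Fin k → ℤ | ∑ i, |x i| = (n : ℤ)}.ncard

/-- The coordination triangle: `c(n,k) = S(n - k, k + 1)` for `0 ≤ k ≤ n`, and `0` for `k > n`. -/
def coordTriangle (n k : ℕ) : ℕ :=
  if k ≤ n then latticeCoord (n - k) (k + 1) else 0

end

/-!
For an array whose row polynomial is `A_n(x) = a(n,n) ∏ (x + r_j)` with `r_j ∈ (t₀, t₁)`, the
normalized row has the generating function `∏ ((1 - p_j) + p_j x)`, `p_j = 1 / (1 + r_j)`: it is
the law of a sum of `n` independent Bernoulli variables (`exists_isBernoulliSum`), whose variances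
`p_j (1 - p_j)` are bounded below by a constant `c > 0`. Hence `c n ≤ σ_n²`, so that `σ_n → ∞`.

The local limit theorem follows by Fourier inversion
(`abs_rowStdDev_mul_normProb_sub_le`): the error, uniformly in the lattice point, is at most the
`L¹` distance between the characteristic function of the standardized row, cut off at `±π σ_n`,
and `exp (-s² / 2)`. The bound `exp (-(2 / π²) t² p (1 - p))` for the characteristic function of a
single centred Bernoulli variable on `[-π, π]` provides an integrable majorant, and its
second-order Taylor expansion provides pointwise convergence with error `O(n / σ_n³)`, so dominated
convergence applies (`tendsto_integral_centeredCharFun_sub`).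

The central limit theorem is a consequence of the local one and `σ_n → ∞`
(`AsympNormalLLT.asympNormalCLT`). The step function `x ↦ σ_n p(n, ⌊μ_n + x σ_n⌋)` is a probability
density; it converges pointwise to the Gaussian density, hence in `L¹` by Scheffé's lemma, and its
distribution function differs from that of the row by at most one atom, of size `O(1 / σ_n)`.

For the coordination triangle, the recurrence for `S(n,k)` (`latticeCoord_succ_succ`) gives
`C_{n+2} = (1 + x) C_{n+1} + x C_n`. With `x = -y²` and `1 - y² = 2 y cos θ` this is solved by
`y sin θ C_n(x) = y^n (y sin ((n+1) θ) + sin (n θ))` (`coordPoly_eval_neg_sq`), so that `C_n`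
alternates in sign at the points belonging to `θ = j π / (n+1)`, `1 ≤ j ≤ n + 1`. This yields `n`
distinct real zeros, all between `-(√2 + 1)²` and `-(√2 - 1)²`, the values for `θ = π` and `θ = 0`,
and the general theorem applies.
-/

/-! ### Rows of real-rooted arrays as sums of Bernoulli variables -/

/-- The `n`-th normalized row of `a` is the law of a sum of `n` independent Bernoulli variables
with success probabilities `p j`, expressed as an identity of probability generating functions. -/
def IsBernoulliSum (a : ℕ → ℕ → ℝ) (n : ℕ) (p : Fin n → ℝ) : Prop :=
  ∑ k ∈ Finset.range (n + 1), Polynomial.C (normProb a n k) * Polynomial.X ^ k =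
    ∏ j, (Polynomial.C (1 - p j) + Polynomial.C (p j) * Polynomial.X)

namespace IsBernoulliSum

open Polynomial in
/-- For generating functions with value `1` at `1`, means and variances
`P''(1) + P'(1) - P'(1)²` add up under multiplication. -/
lemma eval_derivative_prod_linear {ι : Type*} (s : Finset ι) (p : ι → ℝ) :
    (∏ j ∈ s, (C (1 - p j) + C (p j) * X)).eval 1 = 1 ∧
    (derivative (∏ j ∈ s, (C (1 - p j) + C (p j) * X))).eval 1 = ∑ j ∈ s, p j ∧
    (derivative (derivative (∏ j ∈ s, (C (1 - p j) + C (p j) * X)))).eval 1 +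
      ∑ j ∈ s, p j - (∑ j ∈ s, p j) ^ 2 = ∑ j ∈ s, p j * (1 - p j) := by
  classical
  induction s using Finset.induction_on with
  | empty => simp
  | insert i s hi ih =>
    obtain ⟨h0, h1, h2⟩ := ih
    simp only [Finset.prod_insert hi, Finset.sum_insert hi]
    refine ⟨by rw [eval_mul, h0]; simp, ?_, ?_⟩
    · rw [derivative_mul, eval_add, eval_mul, eval_mul, h0, h1]; simp
    simp only [derivative_mul, derivative_add, derivative_C, derivative_X, eval_add, eval_mul,
      eval_C, eval_X, h1, zero_mul, zero_add, mul_one,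
      sub_add_cancel, one_mul]
    linear_combination h2

variable {a : ℕ → ℕ → ℝ} {n : ℕ} {p : Fin n → ℝ}

lemma sum_normProb (h : IsBernoulliSum a n p) :
    ∑ k ∈ Finset.range (n + 1), normProb a n k = 1 := by
  have := congrArg (Polynomial.eval 1) h
  rw [(eval_derivative_prod_linear _ _).1] at this
  simpa [Polynomial.eval_finsetSum] using this

lemma rowMean_eq (h : IsBernoulliSum a n p) : rowMean a n = ∑ j, p j := by
  have := congrArg (fun Q => Polynomial.eval 1 (Polynomial.derivative Q)) h
  simp only [(eval_derivative_prod_linear _ _).2.1] at this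
  rw [← this, rowMean, Polynomial.derivative_sum, Polynomial.eval_finsetSum]
  exact Finset.sum_congr rfl fun k _ => by
    simp [Polynomial.derivative_X_pow]; ring

lemma rowVariance_eq (h : IsBernoulliSum a n p) :
    rowVariance a n = ∑ j, p j * (1 - p j) := by
  have h2 := congrArg
    (fun Q => Polynomial.eval 1 (Polynomial.derivative (Polynomial.derivative Q))) h
  have h3 := (eval_derivative_prod_linear Finset.univ p).2.2
  rw [← h3, ← h2, ← h.rowMean_eq]
  have h4 : Polynomial.eval 1 (Polynomial.derivative (Polynomial.derivative
      (∑ k ∈ Finset.range (n + 1), Polynomial.C (normProb a n k) * Polynomial.X ^ k))) =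
      ∑ k ∈ Finset.range (n + 1), ((k : ℝ) ^ 2 * normProb a n k - k * normProb a n k) := by
    simp only [Polynomial.derivative_sum, Polynomial.eval_finsetSum]
    refine Finset.sum_congr rfl fun k _ => ?_
    cases k with
    | zero => simp
    | succ k => simp [Polynomial.derivative_X_pow]; ring
  have h5 : rowVariance a n = ∑ k ∈ Finset.range (n + 1), (k : ℝ) ^ 2 * normProb a n k -
      2 * rowMean a n * ∑ k ∈ Finset.range (n + 1), (k : ℝ) * normProb a n k +
      rowMean a n ^ 2 * ∑ k ∈ Finset.range (n + 1), normProb a n k := by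
    rw [rowVariance, Finset.mul_sum, Finset.mul_sum, ← Finset.sum_sub_distrib,
      ← Finset.sum_add_distrib]
    exact Finset.sum_congr rfl fun k _ => by ring
  have h6 : ∑ k ∈ Finset.range (n + 1), (k : ℝ) * normProb a n k = rowMean a n := rfl
  simp only [h4, h5, Finset.sum_sub_distrib, h.sum_normProb, h6]
  ring

/-- The characteristic function of the centred row is a product of those of the centred
Bernoulli variables. -/
lemma sum_normProb_mul_exp (h : IsBernoulliSum a n p) (t : ℝ) :
    ∑ k ∈ Finset.range (n + 1),
      (normProb a n k : ℂ) * Complex.exp (Complex.I * (((k : ℝ) - rowMean a n) * t : ℝ)) =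
    ∏ j, ((1 - p j : ℝ) * Complex.exp (Complex.I * (-(p j) * t : ℝ)) +
      (p j : ℝ) * Complex.exp (Complex.I * ((1 - p j) * t : ℝ))) := by
  have := congrArg (Polynomial.aeval (Complex.exp (Complex.I * t))) h
  simp only [map_sum, map_prod, map_mul, map_add, map_pow, Polynomial.aeval_C,
    Polynomial.aeval_X, Complex.coe_algebraMap] at this
  have e1 : ∀ j, ((1 - p j : ℝ) * Complex.exp (Complex.I * (-(p j) * t : ℝ)) +
      (p j : ℝ) * Complex.exp (Complex.I * ((1 - p j) * t : ℝ)) : ℂ) =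
      Complex.exp (Complex.I * (-(p j) * t : ℝ)) *
        ((1 - p j : ℝ) + (p j : ℝ) * Complex.exp (Complex.I * t)) := by
    intro j
    have : Complex.exp (Complex.I * ((1 - p j) * t : ℝ)) =
      Complex.exp (Complex.I * (-(p j) * t : ℝ)) * Complex.exp (Complex.I * t) := by
      rw [← Complex.exp_add]; congr 1; push_cast; ring
    rw [this]; ring
  simp only [e1, Finset.prod_mul_distrib]
  rw [← this, ← Complex.exp_sum, Finset.mul_sum]
  refine Finset.sum_congr rfl fun k _ => ?_
  have e2 : Complex.exp (Complex.I * (((k : ℝ) - rowMean a n) * t : ℝ)) =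
      Complex.exp (∑ j, Complex.I * (-(p j) * t : ℝ)) * Complex.exp (Complex.I * t) ^ k := by
    rw [← Complex.exp_nat_mul, ← Complex.exp_add, ← Finset.mul_sum, ← Complex.ofReal_sum,
      ← Finset.sum_mul, Finset.sum_neg_distrib, h.rowMean_eq]
    congr 1; push_cast; ring
  rw [e2]; ring

end IsBernoulliSum

lemma rowPoly_coeff (a : ℕ → ℕ → ℝ) (n k : ℕ) :
    (rowPoly a n).coeff k = if k ≤ n then a n k else 0 := by
  simp [rowPoly, Polynomial.coeff_X_pow]

lemma rowPoly_natDegree {a : ℕ → ℕ → ℝ} {n : ℕ} (h : a n n ≠ 0) :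
    (rowPoly a n).natDegree = n := by
  refine le_antisymm ?_ (Polynomial.le_natDegree_of_ne_zero (by simpa [rowPoly_coeff] using h))
  rw [Polynomial.natDegree_le_iff_coeff_eq_zero]
  intro k hk
  simp [rowPoly_coeff, hk.not_ge]

lemma OnlyRealZeros.splits {p : Polynomial ℝ} (h : OnlyRealZeros p) : p.Splits := by
  refine Polynomial.Splits.of_splits_map (algebraMap ℝ ℂ) (IsAlgClosed.splits _) fun z hz => ?_
  have := h z (by simpa [Polynomial.aeval_def, Polynomial.eval_map] using
    Polynomial.isRoot_of_mem_roots hz)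
  exact ⟨z.re, Complex.ext (by simp) (by simp [this])⟩

lemma Multiset.exists_fin_map {α : Type*} (s : Multiset α) {n : ℕ} (h : s.card = n) :
    ∃ f : Fin n → α, (Finset.univ.val.map f) = s := by
  subst h
  refine ⟨fun i => s.toList.get (i.cast (by simp)), ?_⟩
  conv_rhs => rw [← s.coe_toList]
  rw [Fin.univ_val_map, Multiset.coe_eq_coe]
  refine List.Perm.of_eq (List.ext_getElem (by simp) fun i _ _ => by simp)

/-- Writing `A_n(x) = a(n,n) ∏ (x + r_j)`, the normalized row is the law of a sum of independent
Bernoulli variables with success probabilities `1 / (1 + r_j)`. -/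
lemma exists_isBernoulliSum {a : ℕ → ℕ → ℝ} {n : ℕ} {t₀ t₁ : ℝ} (ht₀ : 0 < t₀)
    (hn : a n n ≠ 0) (hz : OnlyRealZeros (rowPoly a n))
    (hr : ∀ x : ℝ, (rowPoly a n).IsRoot x → x ∈ Set.Ioo (-t₁) (-t₀)) :
    ∃ p : Fin n → ℝ, IsBernoulliSum a n p ∧
      ∀ j, 0 ≤ p j ∧ p j ≤ 1 ∧ t₀ / (1 + t₁) ^ 2 ≤ p j * (1 - p j) := by
  have hdeg := rowPoly_natDegree hn
  have hne : rowPoly a n ≠ 0 := fun h0 => hn (by simpa [h0] using (rowPoly_coeff a n n).symm)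
  have hs := hz.splits
  obtain ⟨x, hx⟩ := Multiset.exists_fin_map (rowPoly a n).roots
    ((Polynomial.splits_iff_card_roots.1 hs).trans hdeg)
  have hx' : ∀ j, x j ∈ Set.Ioo (-t₁) (-t₀) := fun j => hr _ (Polynomial.isRoot_of_mem_roots
    (by rw [← hx]; exact Multiset.mem_map_of_mem _ (Finset.mem_univ j)))
  have hx1 : ∀ j, 0 < 1 - x j := fun j => by linarith [(hx' j).2]
  have hprod : rowPoly a n = Polynomial.C (a n n) *
      ∏ j, (Polynomial.X - Polynomial.C (x j)) := by
    conv_lhs => rw [hs.eq_prod_roots, ← hx, Multiset.map_map]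
    rw [Polynomial.leadingCoeff, hdeg, rowPoly_coeff, if_pos le_rfl]
    rfl
  have hsum : ∑ j ∈ Finset.range (n + 1), a n j = a n n * ∏ j, (1 - x j) := by
    have := congrArg (Polynomial.eval 1) hprod
    simpa [rowPoly, Polynomial.eval_finsetSum, Polynomial.eval_prod] using this
  have hprod_ne : ∏ j, (1 - x j) ≠ 0 := Finset.prod_ne_zero_iff.2 fun j _ => (hx1 j).ne'
  refine ⟨fun j => 1 / (1 - x j), ?_, fun j => ⟨?_, ?_, ?_⟩⟩
  · have h1 : ∑ k ∈ Finset.range (n + 1), Polynomial.C (normProb a n k) * Polynomial.X ^ k =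
        Polynomial.C (∑ j ∈ Finset.range (n + 1), a n j)⁻¹ * rowPoly a n := by
      rw [rowPoly, Finset.mul_sum]
      refine Finset.sum_congr rfl fun k hk => ?_
      have : (k : ℤ) ≤ n := by have := Finset.mem_range.1 hk; omega
      rw [normProb, if_pos ⟨by simp, this⟩, Int.toNat_natCast, div_eq_inv_mul,
        Polynomial.C_mul, mul_assoc]
    have h2 : ∀ j, Polynomial.C (1 - 1 / (1 - x j)) + Polynomial.C (1 / (1 - x j)) *
        Polynomial.X = Polynomial.C (1 - x j)⁻¹ * (Polynomial.X - Polynomial.C (x j)) := by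
      intro j
      have : 1 - 1 / (1 - x j) = -((1 - x j)⁻¹ * x j) := by
        field_simp [(hx1 j).ne']; ring
      rw [this, one_div, Polynomial.C_neg, Polynomial.C_mul]; ring
    rw [IsBernoulliSum, h1]
    simp only [h2]
    rw [Finset.prod_mul_distrib, hprod, ← mul_assoc, ← Polynomial.C_mul, hsum, ← map_prod,
      Finset.prod_inv_distrib]
    congr 2
    field_simp
  · have := hx1 j; positivity
  · rw [div_le_one (hx1 j)]; linarith [(hx' j).2]
  · have h3 := hx1 j
    have h4 := hx' j
    have : 1 / (1 - x j) * (1 - 1 / (1 - x j)) = -x j / (1 - x j) ^ 2 := by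
      field_simp; ring
    rw [this]
    apply div_le_div₀ <;> nlinarith [h4.1, h4.2]

/-! ### Characteristic functions and Fourier inversion -/

/-- Global bound on the centred Bernoulli characteristic function, from
`|(1 - p) + p exp (i t)|² = 1 - 2 p (1 - p) (1 - cos t)` and Jordan's inequality. -/
lemma norm_centered_bernoulli_charFun_le {p t : ℝ} (hp0 : 0 ≤ p) (hp1 : p ≤ 1)
    (ht : |t| ≤ Real.pi) :
    ‖((1 - p : ℝ) * Complex.exp (Complex.I * (-p * t : ℝ)) +
      (p : ℝ) * Complex.exp (Complex.I * ((1 - p) * t : ℝ)) : ℂ)‖ ≤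
      Real.exp (-(2 / Real.pi ^ 2) * t ^ 2 * (p * (1 - p))) := by
  have hpq : 0 ≤ p * (1 - p) := mul_nonneg hp0 (by linarith)
  have h1 : ‖((1 - p : ℝ) * Complex.exp (Complex.I * (-p * t : ℝ)) +
      (p : ℝ) * Complex.exp (Complex.I * ((1 - p) * t : ℝ)) : ℂ)‖ ^ 2 =
      1 - 2 * (p * (1 - p)) * (1 - Real.cos t) := by
    rw [← Complex.normSq_eq_norm_sq, mul_comm Complex.I, mul_comm Complex.I,
      Complex.exp_mul_I, Complex.exp_mul_I, ← Complex.ofReal_cos, ← Complex.ofReal_sin,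
      ← Complex.ofReal_cos, ← Complex.ofReal_sin, Complex.normSq_apply]
    have hc : Real.cos t = Real.cos (p * t) * Real.cos ((1 - p) * t) -
        Real.sin (p * t) * Real.sin ((1 - p) * t) := by
      rw [← Real.cos_add]; congr 1; ring
    simp only [neg_mul, Real.cos_neg, Real.sin_neg, Complex.add_re, Complex.add_im,
      Complex.mul_re, Complex.mul_im, Complex.ofReal_re, Complex.ofReal_im, Complex.I_re,
      Complex.I_im]
    rw [hc]
    linear_combination (1 - p) ^ 2 * Real.sin_sq_add_cos_sq (p * t) +
      p ^ 2 * Real.sin_sq_add_cos_sq ((1 - p) * t)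
  refine (sq_le_sq₀ (norm_nonneg _) (Real.exp_pos _).le).1 ?_
  rw [h1, ← Real.exp_nat_mul]
  have h2 := Real.cos_le_one_sub_mul_cos_sq ht
  have h3 := Real.add_one_le_exp (-(2 * (p * (1 - p)) * (1 - Real.cos t)))
  refine (by linarith : _ ≤ Real.exp (-(2 * (p * (1 - p)) * (1 - Real.cos t)))).trans
    (Real.exp_le_exp.2 ?_)
  push_cast
  nlinarith

/-- Near the origin the centred Bernoulli characteristic function is that of the Gaussian law with
the same variance, up to third order. -/
lemma norm_centered_bernoulli_charFun_sub_le {p t : ℝ} (hp0 : 0 ≤ p) (hp1 : p ≤ 1)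
    (ht : |t| ≤ 1) :
    ‖((1 - p : ℝ) * Complex.exp (Complex.I * (-p * t : ℝ)) +
      (p : ℝ) * Complex.exp (Complex.I * ((1 - p) * t : ℝ)) -
      Complex.exp ((-(p * (1 - p)) * t ^ 2 / 2 : ℝ)) : ℂ)‖ ≤ 3 * |t| ^ 3 := by
  have hq0 : 0 ≤ 1 - p := by linarith
  have ht0 := abs_nonneg t
  have key : ∀ u : ℝ, |u| ≤ 1 → ‖Complex.exp (Complex.I * (u * t : ℝ)) -
      (1 + Complex.I * (u * t : ℝ) - (u * t : ℝ) ^ 2 / 2)‖ ≤ |t| ^ 3 := by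
    intro u hu
    have hx : ‖Complex.I * (u * t : ℝ)‖ ≤ |t| := by
      rw [norm_mul, Complex.norm_I, one_mul, Complex.norm_real, Real.norm_eq_abs, abs_mul]
      nlinarith
    have := Complex.exp_bound (hx.trans ht) (n := 3) (by norm_num)
    have e : ∑ m ∈ Finset.range 3, (Complex.I * (u * t : ℝ)) ^ m / (m.factorial : ℂ) =
        1 + Complex.I * (u * t : ℝ) - (u * t : ℝ) ^ 2 / 2 := by
      simp [Finset.sum_range_succ, Nat.factorial, mul_pow]; ring
    rw [e] at this
    refine this.trans ?_
    calc _ ≤ |t| ^ 3 * 1 := by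
          gcongr
          norm_num [Nat.factorial]
      _ = _ := mul_one _
  have k1 := key (-p) (by rw [abs_neg, abs_of_nonneg hp0]; exact hp1)
  have k2 := key (1 - p) (by rw [abs_of_nonneg hq0]; linarith)
  have hpq : 0 ≤ p * (1 - p) := mul_nonneg hp0 hq0
  have hpq1 : p * (1 - p) ≤ 1 := by nlinarith
  have ht2 : t ^ 2 = |t| ^ 2 := (sq_abs t).symm
  have hx : ‖((-(p * (1 - p)) * t ^ 2 / 2 : ℝ) : ℂ)‖ ≤ |t| ^ 2 := by
    rw [Complex.norm_real, Real.norm_eq_abs, ← ht2, neg_mul, neg_div, abs_neg,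
      abs_of_nonneg (by positivity)]
    nlinarith [sq_nonneg t]
  have k3 := Complex.norm_exp_sub_one_sub_id_le (hx.trans (pow_le_one₀ ht0 ht))
  have k3' := k3.trans (pow_le_pow_left₀ (norm_nonneg _) hx 2)
  have h4 : (|t| ^ 2) ^ 2 ≤ |t| ^ 3 := by
    calc (|t| ^ 2) ^ 2 = |t| ^ 3 * |t| := by ring
      _ ≤ |t| ^ 3 * 1 := by gcongr
      _ = _ := mul_one _
  set E1 := Complex.exp (Complex.I * (-p * t : ℝ))
  set E2 := Complex.exp (Complex.I * ((1 - p) * t : ℝ))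
  set E3 := Complex.exp ((-(p * (1 - p)) * t ^ 2 / 2 : ℝ))
  -- The Taylor polynomials of degree two agree, since the variance is `p (1 - p)`.
  have split : ((1 - p : ℝ) * E1 + (p : ℝ) * E2 - E3 : ℂ) =
      (1 - p : ℝ) * (E1 - (1 + Complex.I * (-p * t : ℝ) - (-p * t : ℝ) ^ 2 / 2)) +
      (p : ℝ) * (E2 - (1 + Complex.I * ((1 - p) * t : ℝ) - ((1 - p) * t : ℝ) ^ 2 / 2)) -
      (E3 - 1 - (-(p * (1 - p)) * t ^ 2 / 2 : ℝ)) := by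
    push_cast; ring
  rw [split]
  refine (norm_sub_le _ _).trans (le_trans (add_le_add_left (norm_add_le _ _) _) ?_)
  rw [norm_mul, norm_mul, Complex.norm_real, Complex.norm_real, Real.norm_eq_abs,
    Real.norm_eq_abs, abs_of_nonneg hp0, abs_of_nonneg hq0]
  have : 0 ≤ |t| ^ 3 := by positivity
  nlinarith [mul_le_mul_of_nonneg_left k1 hq0, mul_le_mul_of_nonneg_left k2 hp0]

lemma norm_prod_sub_prod_le_sum {ι R : Type*} [NormedCommRing R] [NormOneClass R]
    (s : Finset ι) (f g : ι → R) (hf : ∀ i ∈ s, ‖f i‖ ≤ 1) (hg : ∀ i ∈ s, ‖g i‖ ≤ 1) :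
    ‖∏ i ∈ s, f i - ∏ i ∈ s, g i‖ ≤ ∑ i ∈ s, ‖f i - g i‖ := by
  classical
  induction s using Finset.induction_on with
  | empty => simp
  | insert i s hi ih =>
    simp only [Finset.forall_mem_insert] at hf hg
    rw [Finset.prod_insert hi, Finset.prod_insert hi, Finset.sum_insert hi]
    have h1 : ‖∏ j ∈ s, f j‖ ≤ 1 :=
      (Finset.norm_prod_le _ _).trans (Finset.prod_le_one (fun _ _ => norm_nonneg _) hf.2)
    have h2 : f i * ∏ j ∈ s, f j - g i * ∏ j ∈ s, g j =
        (f i - g i) * ∏ j ∈ s, f j + g i * (∏ j ∈ s, f j - ∏ j ∈ s, g j) := by ring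
    rw [h2]
    refine (norm_add_le _ _).trans (add_le_add ?_ ?_)
    · exact (norm_mul_le _ _).trans (mul_le_of_le_one_right (norm_nonneg _) h1)
    · exact (norm_mul_le _ _).trans ((mul_le_of_le_one_left (norm_nonneg _) hg.1).trans
        (ih hf.2 hg.2))

/-- The Gaussian density is recovered from its characteristic function `exp (-s² / 2)`. -/
lemma integral_gaussian_fourier (y : ℝ) :
    ∫ s : ℝ, Complex.exp (-(s : ℂ) ^ 2 / 2) * Complex.exp (-Complex.I * (s * y)) =
      2 * Real.pi * ((1 / √(2 * Real.pi) * Real.exp (-y ^ 2 / 2) : ℝ) : ℂ) := by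
  have h := fourierIntegral_gaussian (b := 1 / 2) (by norm_num) (-y : ℂ)
  have e : (fun s : ℝ => Complex.exp (-(s : ℂ) ^ 2 / 2) * Complex.exp (-Complex.I * (s * y))) =
      fun s : ℝ => Complex.exp (Complex.I * (-y) * s) * Complex.exp (-(1 / 2) * (s : ℂ) ^ 2) := by
    funext s
    rw [mul_comm]
    congr 2 <;> ring
  rw [e, h]
  have h2 : ((Real.pi : ℂ) / (1 / 2)) ^ (1 / 2 : ℂ) = (√(2 * Real.pi) : ℝ) := by
    rw [Real.sqrt_eq_rpow, Complex.ofReal_cpow (by positivity)]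
    congr 1 <;> push_cast <;> ring
  have h3 : (2 * Real.pi : ℂ) = (√(2 * Real.pi) : ℝ) * (√(2 * Real.pi) : ℝ) := by
    rw [← Complex.ofReal_mul, Real.mul_self_sqrt (by positivity)]; push_cast; ring
  have h4 : ((√(2 * Real.pi) : ℝ) : ℂ) ≠ 0 := by
    rw [Complex.ofReal_ne_zero]; positivity
  rw [h2, h3]
  push_cast
  field_simp
  congr 1
  ring

lemma integral_exp_int_mul (m : ℤ) :
    ∫ t in (-Real.pi)..Real.pi, Complex.exp (Complex.I * (m * t)) =
      if m = 0 then (2 * Real.pi : ℂ) else 0 := by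
  split_ifs with h
  · simp [h]; ring
  · have hc : Complex.I * m ≠ 0 := mul_ne_zero Complex.I_ne_zero (by exact_mod_cast h)
    simp only [← mul_assoc]
    rw [integral_exp_mul_complex hc]
    have : Complex.exp (Complex.I * m * (Real.pi : ℝ)) =
        Complex.exp (Complex.I * m * (-Real.pi : ℝ)) := by
      rw [Complex.exp_eq_exp_iff_exists_int]
      exact ⟨m, by push_cast; ring⟩
    rw [this, sub_self, zero_div]

/-- The characteristic function of the `n`-th row, centred at its mean. -/
noncomputable def centeredCharFun (a : ℕ → ℕ → ℝ) (n : ℕ) (t : ℝ) : ℂ :=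
  ∑ k ∈ Finset.range (n + 1),
    (normProb a n k : ℂ) * Complex.exp (Complex.I * (((k : ℝ) - rowMean a n) * t : ℝ))

@[fun_prop]
lemma continuous_centeredCharFun (a : ℕ → ℕ → ℝ) (n : ℕ) : Continuous (centeredCharFun a n) := by
  unfold centeredCharFun
  fun_prop

lemma integral_centeredCharFun (a : ℕ → ℕ → ℝ) (n : ℕ) (m : ℤ) :
    ∫ t in (-Real.pi)..Real.pi, centeredCharFun a n t *
        Complex.exp (-Complex.I * (((m : ℝ) - rowMean a n) * t : ℝ)) =
      2 * Real.pi * normProb a n m := by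
  have e : ∀ t : ℝ, centeredCharFun a n t *
        Complex.exp (-Complex.I * (((m : ℝ) - rowMean a n) * t : ℝ)) =
      ∑ k ∈ Finset.range (n + 1), (normProb a n k : ℂ) *
        Complex.exp (Complex.I * (((k - m : ℤ) : ℂ) * t)) := by
    intro t
    rw [centeredCharFun, Finset.sum_mul]
    refine Finset.sum_congr rfl fun k _ => ?_
    rw [mul_assoc, ← Complex.exp_add]
    congr 2
    push_cast; ring
  simp only [e]
  rw [intervalIntegral.integral_finsetSum]
  · simp only [intervalIntegral.integral_const_mul, integral_exp_int_mul, sub_eq_zero]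
    by_cases hm : 0 ≤ m ∧ m ≤ n
    · rw [Finset.sum_eq_single m.toNat]
      · rw [if_pos (by omega), Int.toNat_of_nonneg hm.1]; ring
      · intro k _ hk
        rw [if_neg (by omega), mul_zero]
      · intro hk
        exact absurd (Finset.mem_range.2 (by omega)) hk
    · rw [normProb, if_neg hm]
      simp only [Complex.ofReal_zero, mul_zero]
      refine Finset.sum_eq_zero fun k hk => ?_
      rw [if_neg, mul_zero]
      have := Finset.mem_range.1 hk
      omega
  · intro k _
    apply Continuous.intervalIntegrable
    fun_prop

/-- Fourier inversion: the distance of the local probabilities to the Gaussian density is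
bounded, uniformly in `m`, by the `L¹` distance of the characteristic functions. -/
lemma abs_rowStdDev_mul_normProb_sub_le {a : ℕ → ℕ → ℝ} {n : ℕ} (hσ : 0 < rowStdDev a n)
    (m : ℤ) :
    |rowStdDev a n * normProb a n m - 1 / √(2 * Real.pi) *
      Real.exp (-((m - rowMean a n) / rowStdDev a n) ^ 2 / 2)| ≤
    1 / (2 * Real.pi) * ∫ s : ℝ, ‖(Set.Ioc (-(Real.pi * rowStdDev a n))
      (Real.pi * rowStdDev a n)).indicator (fun s => centeredCharFun a n (s / rowStdDev a n)) s -
      Complex.exp (-(s : ℂ) ^ 2 / 2)‖ := by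
  set σ := rowStdDev a n
  set y := (m - rowMean a n) / σ with hy
  set S := Set.Ioc (-(Real.pi * σ)) (Real.pi * σ)
  set G : ℝ → ℂ := S.indicator (fun s => centeredCharFun a n (s / σ))
  have hpi := Real.pi_pos
  have hG : Integrable G := by
    refine (integrable_indicator_iff measurableSet_Ioc).2 ?_
    refine (Continuous.integrableOn_Icc ?_).mono_set Set.Ioc_subset_Icc_self
    fun_prop
  have hg : Integrable (fun s : ℝ => Complex.exp (-(s : ℂ) ^ 2 / 2)) := by
    have := integrable_cexp_neg_mul_sq (b := 1 / 2) (by norm_num)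
    refine this.congr (ae_of_all _ fun s => ?_)
    simp only; congr 1; ring
  have hexp : ∀ s : ℝ, ‖Complex.exp (-Complex.I * (s * y))‖ = 1 := by
    intro s
    have : -Complex.I * (s * y) = ((-(s * y) : ℝ) : ℂ) * Complex.I := by push_cast; ring
    rw [this, Complex.norm_exp_ofReal_mul_I]
  have hcont : Continuous fun s : ℝ => Complex.exp (-Complex.I * (s * y)) := by fun_prop
  have hmul : ∀ F : ℝ → ℂ, Integrable F →
      Integrable fun s : ℝ => F s * Complex.exp (-Complex.I * (s * y)) := fun F hF =>
    hF.mul_bdd hcont.aestronglyMeasurable (c := 1) (ae_of_all _ fun s => (hexp s).le)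
  have h1 : ∫ s, G s * Complex.exp (-Complex.I * (s * y)) =
      2 * Real.pi * ((σ * normProb a n m : ℝ) : ℂ) := by
    have e1 : (fun s => G s * Complex.exp (-Complex.I * (s * y))) = S.indicator
        (fun s => centeredCharFun a n (s / σ) *
          Complex.exp (-Complex.I * (((m : ℝ) - rowMean a n) * (s / σ) : ℝ))) := by
      funext s
      by_cases hs : s ∈ S
      · simp only [G, Set.indicator_of_mem hs]
        congr 2
        rw [hy]; push_cast; ring
      · simp only [G, Set.indicator_of_notMem hs, zero_mul]
    rw [e1, integral_indicator measurableSet_Ioc,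
      ← intervalIntegral.integral_of_le (by nlinarith),
      intervalIntegral.integral_comp_div (f := fun t => centeredCharFun a n t *
          Complex.exp (-Complex.I * (((m : ℝ) - rowMean a n) * t : ℝ))) hσ.ne',
      neg_div, mul_div_cancel_right₀ _ hσ.ne', integral_centeredCharFun, Complex.real_smul]
    push_cast; ring
  have h2 : ∫ s, (G s - Complex.exp (-(s : ℂ) ^ 2 / 2)) * Complex.exp (-Complex.I * (s * y)) =
      2 * Real.pi *
        ((σ * normProb a n m - 1 / √(2 * Real.pi) * Real.exp (-y ^ 2 / 2) : ℝ) : ℂ) := by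
    simp only [sub_mul]
    rw [integral_sub (hmul _ hG) (hmul _ hg), h1, integral_gaussian_fourier]
    push_cast; ring
  have h3 := norm_integral_le_integral_norm (μ := volume)
    (fun s : ℝ => (G s - Complex.exp (-(s : ℂ) ^ 2 / 2)) * Complex.exp (-Complex.I * (s * y)))
  rw [h2] at h3
  simp only [norm_mul, hexp, mul_one, Complex.norm_real, Real.norm_eq_abs] at h3
  rw [abs_of_pos hpi, Complex.norm_ofNat] at h3
  rw [one_div_mul_eq_div (2 * Real.pi), le_div_iff₀ (by positivity), mul_comm]
  exact h3

/-! ### The local limit theorem -/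

lemma tendsto_iSup_ofReal_zero_iff {g : ℕ → ℝ → ℝ} :
    Tendsto (fun n => ⨆ x, ENNReal.ofReal (g n x)) atTop (𝓝 0) ↔
      ∀ ε > 0, ∀ᶠ n in atTop, ∀ x, g n x ≤ ε := by
  rw [ENNReal.tendsto_nhds_zero]
  constructor
  · intro h ε hε
    filter_upwards [h (ENNReal.ofReal ε) (ENNReal.ofReal_pos.2 hε)] with n hn x
    exact (ENNReal.ofReal_le_ofReal_iff hε.le).1 ((le_iSup _ x).trans hn)
  · intro h ε hε
    obtain ⟨δ, hδ, hδε⟩ : ∃ δ : ℝ, 0 < δ ∧ ENNReal.ofReal δ ≤ ε := by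
      rcases eq_or_ne ε ⊤ with rfl | hε'
      · exact ⟨1, one_pos, le_top⟩
      · exact ⟨ε.toReal, ENNReal.toReal_pos hε.ne' hε', ENNReal.ofReal_toReal_le⟩
    filter_upwards [h δ hδ] with n hn
    exact iSup_le fun x => (ENNReal.ofReal_le_ofReal (hn x)).trans hδε

/-- The standard Gaussian density is `1`-Lipschitz. -/
lemma abs_gaussian_sub_le (x y : ℝ) :
    |1 / √(2 * Real.pi) * Real.exp (-x ^ 2 / 2) -
      1 / √(2 * Real.pi) * Real.exp (-y ^ 2 / 2)| ≤ |x - y| := by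
  have hd : ∀ x : ℝ, HasDerivAt (fun x : ℝ => Real.exp (-x ^ 2 / 2))
      (Real.exp (-x ^ 2 / 2) * (-x)) x := by
    intro x
    have := (((hasDerivAt_pow 2 x).neg).div_const 2).exp
    refine this.congr_deriv ?_
    simp only [Pi.neg_apply]; push_cast; ring
  have hb : ∀ x ∈ (Set.univ : Set ℝ), ‖Real.exp (-x ^ 2 / 2) * (-x)‖ ≤ 1 := by
    intro x _
    rw [norm_mul, norm_neg, Real.norm_eq_abs, Real.norm_eq_abs, Real.abs_exp, neg_div,
      Real.exp_neg, inv_mul_le_one₀ (Real.exp_pos _)]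
    have := Real.add_one_le_exp (x ^ 2 / 2)
    nlinarith [sq_abs x, sq_nonneg (|x| - 1)]
  have h := convex_univ.norm_image_sub_le_of_norm_hasDerivWithin_le
    (fun x _ => (hd x).hasDerivWithinAt) hb (Set.mem_univ y) (Set.mem_univ x)
  rw [one_mul, Real.norm_eq_abs, Real.norm_eq_abs] at h
  rw [← mul_sub, abs_mul, abs_of_nonneg (by positivity)]
  refine (mul_le_of_le_one_left (abs_nonneg _) ?_).trans h
  rw [div_le_one (by positivity)]
  exact Real.one_le_sqrt.2 (by linarith [Real.pi_gt_three])

section BernoulliRows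

variable {a : ℕ → ℕ → ℝ} {p : ∀ n, Fin n → ℝ} {c : ℝ}

lemma rowStdDev_sq_eq_and_le (hp : ∀ n, IsBernoulliSum a n (p n))
    (hpc : ∀ n j, c ≤ p n j * (1 - p n j)) (hc : 0 < c) (n : ℕ) :
    rowStdDev a n ^ 2 = ∑ j, p n j * (1 - p n j) ∧ c * n ≤ rowStdDev a n ^ 2 := by
  have h : c * n ≤ rowVariance a n := by
    rw [(hp n).rowVariance_eq]
    calc c * n = ∑ _j : Fin n, c := by simp [mul_comm]
      _ ≤ _ := Finset.sum_le_sum fun j _ => hpc n j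
  have h0 : 0 ≤ c * n := by positivity
  rw [rowStdDev, Real.sq_sqrt (h0.trans h)]
  exact ⟨(hp n).rowVariance_eq, h⟩

lemma tendsto_rowStdDev (hp : ∀ n, IsBernoulliSum a n (p n))
    (hpc : ∀ n j, c ≤ p n j * (1 - p n j)) (hc : 0 < c) :
    Tendsto (rowStdDev a) atTop atTop := by
  have h1 : Tendsto (fun n : ℕ => √(c * n)) atTop atTop :=
    Real.tendsto_sqrt_atTop.comp (tendsto_natCast_atTop_atTop.const_mul_atTop hc)
  refine tendsto_atTop_mono (fun n => ?_) h1
  exact Real.sqrt_le_iff.2 ⟨Real.sqrt_nonneg _, (rowStdDev_sq_eq_and_le hp hpc hc n).2⟩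

lemma norm_centeredCharFun_le (hp : ∀ n, IsBernoulliSum a n (p n))
    (hpc : ∀ n j, c ≤ p n j * (1 - p n j)) (hc : 0 < c)
    (hp0 : ∀ n j, 0 ≤ p n j) (hp1 : ∀ n j, p n j ≤ 1) (n : ℕ) {t : ℝ} (ht : |t| ≤ Real.pi) :
    ‖centeredCharFun a n t‖ ≤ Real.exp (-(2 / Real.pi ^ 2) * (rowStdDev a n * t) ^ 2) := by
  rw [centeredCharFun, (hp n).sum_normProb_mul_exp, norm_prod, mul_pow,
    (rowStdDev_sq_eq_and_le hp hpc hc n).1]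
  refine (Finset.prod_le_prod (fun _ _ => norm_nonneg _) fun j _ =>
    norm_centered_bernoulli_charFun_le (hp0 n j) (hp1 n j) ht).trans (le_of_eq ?_)
  rw [← Real.exp_sum, ← Finset.mul_sum]
  congr 1; ring

lemma norm_centeredCharFun_sub_le (hp : ∀ n, IsBernoulliSum a n (p n))
    (hpc : ∀ n j, c ≤ p n j * (1 - p n j)) (hc : 0 < c)
    (hp0 : ∀ n j, 0 ≤ p n j) (hp1 : ∀ n j, p n j ≤ 1) (n : ℕ) {t : ℝ} (ht : |t| ≤ 1) :
    ‖centeredCharFun a n t - Complex.exp (-((rowStdDev a n * t : ℝ) : ℂ) ^ 2 / 2)‖ ≤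
      3 * n * |t| ^ 3 := by
  have e : Complex.exp (-((rowStdDev a n * t : ℝ) : ℂ) ^ 2 / 2) =
      ∏ j, Complex.exp ((-(p n j * (1 - p n j)) * t ^ 2 / 2 : ℝ)) := by
    rw [← Complex.exp_sum, ← Complex.ofReal_sum, ← Finset.sum_div, ← Finset.sum_mul,
      Finset.sum_neg_distrib, ← (rowStdDev_sq_eq_and_le hp hpc hc n).1]
    congr 1; push_cast; ring
  rw [e, centeredCharFun, (hp n).sum_normProb_mul_exp]
  refine (norm_prod_sub_prod_le_sum _ _ _ ?_ ?_).trans ?_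
  · intro j _
    refine (norm_centered_bernoulli_charFun_le (hp0 n j) (hp1 n j)
      (ht.trans (by linarith [Real.pi_gt_three]))).trans (Real.exp_le_one_iff.2 ?_)
    have : 0 ≤ 2 / Real.pi ^ 2 * t ^ 2 * (p n j * (1 - p n j)) := by
      have := hc.le.trans (hpc n j)
      positivity
    linarith
  · intro j _
    rw [← Complex.ofReal_exp, Complex.norm_real, Real.norm_eq_abs, Real.abs_exp]
    refine Real.exp_le_one_iff.2 ?_
    have : 0 ≤ (p n j * (1 - p n j)) * t ^ 2 / 2 := by
      have := hc.le.trans (hpc n j)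
      positivity
    linarith
  · calc _ ≤ ∑ _j : Fin n, 3 * |t| ^ 3 := Finset.sum_le_sum fun j _ =>
          norm_centered_bernoulli_charFun_sub_le (hp0 n j) (hp1 n j) ht
      _ = _ := by simp; ring

/-- The characteristic functions of the standardized rows converge to the Gaussian one in `L¹`,
by dominated convergence: `exp (-(2 / π²) s²)` is a common majorant. -/
lemma tendsto_integral_centeredCharFun_sub (hp : ∀ n, IsBernoulliSum a n (p n))
    (hpc : ∀ n j, c ≤ p n j * (1 - p n j)) (hc : 0 < c)
    (hp0 : ∀ n j, 0 ≤ p n j) (hp1 : ∀ n j, p n j ≤ 1) :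
    Tendsto (fun n => ∫ s : ℝ, ‖(Set.Ioc (-(Real.pi * rowStdDev a n))
      (Real.pi * rowStdDev a n)).indicator (fun s => centeredCharFun a n (s / rowStdDev a n)) s -
      Complex.exp (-(s : ℂ) ^ 2 / 2)‖) atTop (𝓝 0) := by
  have hσ := tendsto_rowStdDev hp hpc hc
  have hexp : ∀ s : ℝ, ‖Complex.exp (-(s : ℂ) ^ 2 / 2)‖ = Real.exp (-(1 / 2) * s ^ 2) := by
    intro s
    have : -(s : ℂ) ^ 2 / 2 = ((-(1 / 2) * s ^ 2 : ℝ) : ℂ) := by push_cast; ring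
    rw [this, ← Complex.ofReal_exp, Complex.norm_real, Real.norm_eq_abs, Real.abs_exp]
  rw [← integral_zero ℝ ℝ]
  refine tendsto_integral_filter_of_dominated_convergence
    (fun s => Real.exp (-(2 / Real.pi ^ 2) * s ^ 2) + Real.exp (-(1 / 2) * s ^ 2))
    (Eventually.of_forall fun n => ?_) ?_
    ((integrable_exp_neg_mul_sq (by positivity)).add (integrable_exp_neg_mul_sq (by norm_num)))
    (ae_of_all _ fun s => ?_)
  · refine AEStronglyMeasurable.norm (AEStronglyMeasurable.sub
      (AEStronglyMeasurable.indicator ?_ measurableSet_Ioc) ?_)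
    all_goals exact Continuous.aestronglyMeasurable (by fun_prop)
  · filter_upwards [hσ.eventually_gt_atTop 0] with n hn
    refine ae_of_all _ fun s => ?_
    rw [norm_norm]
    refine (norm_sub_le _ _).trans (add_le_add ?_ (hexp s).le)
    by_cases hs : s ∈ Set.Ioc (-(Real.pi * rowStdDev a n)) (Real.pi * rowStdDev a n)
    · rw [Set.indicator_of_mem hs]
      have h1 : |s / rowStdDev a n| ≤ Real.pi := by
        rw [abs_div, abs_of_pos hn, div_le_iff₀ hn]
        exact abs_le.2 ⟨hs.1.le, hs.2⟩
      have := norm_centeredCharFun_le hp hpc hc hp0 hp1 n h1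
      rwa [mul_div_cancel₀ _ hn.ne'] at this
    · rw [Set.indicator_of_notMem hs, norm_zero]
      positivity
  · -- For fixed `s` the error is at most `3 n |s / σ|³ ≤ 3 |s|³ / (c σ)`.
    have hlim : Tendsto (fun n => 3 * |s| ^ 3 / c / rowStdDev a n) atTop (𝓝 0) :=
      hσ.const_div_atTop _
    refine squeeze_zero' (Eventually.of_forall fun n => norm_nonneg _) ?_ hlim
    filter_upwards [hσ.eventually_gt_atTop |s|] with n hn
    have hn0 : 0 < rowStdDev a n := (abs_nonneg s).trans_lt hn
    have h3 := Real.pi_gt_three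
    have hs : s ∈ Set.Ioc (-(Real.pi * rowStdDev a n)) (Real.pi * rowStdDev a n) :=
      ⟨by nlinarith [neg_abs_le s], by nlinarith [le_abs_self s]⟩
    have h1 : |s / rowStdDev a n| ≤ 1 := by
      rw [abs_div, abs_of_pos hn0, div_le_one hn0]; exact hn.le
    have h2 := norm_centeredCharFun_sub_le hp hpc hc hp0 hp1 n h1
    rw [mul_div_cancel₀ _ hn0.ne'] at h2
    rw [Set.indicator_of_mem hs]
    refine h2.trans ?_
    rw [abs_div, abs_of_pos hn0, div_div, le_div_iff₀ (by positivity), div_pow]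
    calc 3 * n * (|s| ^ 3 / rowStdDev a n ^ 3) * (c * rowStdDev a n) =
        3 * |s| ^ 3 / rowStdDev a n ^ 2 * (c * n) := by field_simp
      _ ≤ 3 * |s| ^ 3 / rowStdDev a n ^ 2 * rowStdDev a n ^ 2 := by
        gcongr
        exact (rowStdDev_sq_eq_and_le hp hpc hc n).2
      _ = 3 * |s| ^ 3 := by field_simp

lemma asympNormalLLT_of_isBernoulliSum (hp : ∀ n, IsBernoulliSum a n (p n))
    (hpc : ∀ n j, c ≤ p n j * (1 - p n j)) (hc : 0 < c)
    (hp0 : ∀ n j, 0 ≤ p n j) (hp1 : ∀ n j, p n j ≤ 1) : AsympNormalLLT a := by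
  have hσ := tendsto_rowStdDev hp hpc hc
  refine tendsto_iSup_ofReal_zero_iff.2 fun ε hε => ?_
  have h1 := ((tendsto_integral_centeredCharFun_sub hp hpc hc hp0 hp1).const_mul
    (1 / (2 * Real.pi))).add (hσ.const_div_atTop 1)
  rw [mul_zero, add_zero] at h1
  filter_upwards [h1.eventually_le_const hε, hσ.eventually_gt_atTop 0] with n hn hn0 x
  refine le_trans ?_ hn
  refine (abs_sub_le _ _ _).trans
    (add_le_add (abs_rowStdDev_mul_normProb_sub_le hn0 _) ((abs_gaussian_sub_le _ _).trans ?_))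
  have h2 := Int.floor_le (rowMean a n + x * rowStdDev a n)
  have h3 := Int.lt_floor_add_one (rowMean a n + x * rowStdDev a n)
  have e : (⌊rowMean a n + x * rowStdDev a n⌋ - rowMean a n) / rowStdDev a n - x =
      (⌊rowMean a n + x * rowStdDev a n⌋ - (rowMean a n + x * rowStdDev a n)) /
        rowStdDev a n := by
    field_simp; ring
  rw [e, abs_div, abs_of_pos hn0]
  gcongr
  rw [abs_le]
  constructor <;> linarith

end BernoulliRows

/-! ### From the local to the central limit theorem -/

/-- The step function `x ↦ σ p(n, ⌊μ + x σ⌋)`. It is the density of the standardized row after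
each atom `(k - μ) / σ` is spread uniformly over `[(k - μ) / σ, (k + 1 - μ) / σ)`. -/
noncomputable def rowDensity (a : ℕ → ℕ → ℝ) (n : ℕ) (x : ℝ) : ℝ :=
  rowStdDev a n * normProb a n ⌊rowMean a n + x * rowStdDev a n⌋

/-- The interval of all `x` with `⌊μ + x σ⌋ = k`. -/
def rowCell (a : ℕ → ℕ → ℝ) (n : ℕ) (k : ℕ) : Set ℝ :=
  Set.Ico ((k - rowMean a n) / rowStdDev a n) ((k + 1 - rowMean a n) / rowStdDev a n)

section Density

variable {a : ℕ → ℕ → ℝ} {n : ℕ}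

lemma mem_rowCell (hσ : 0 < rowStdDev a n) {k : ℕ} {x : ℝ} :
    x ∈ rowCell a n k ↔ ⌊rowMean a n + x * rowStdDev a n⌋ = (k : ℤ) := by
  rw [rowCell, Set.mem_Ico, div_le_iff₀ hσ, lt_div_iff₀ hσ, Int.floor_eq_iff]
  push_cast
  constructor <;> rintro ⟨h1, h2⟩ <;> constructor <;> linarith

lemma volume_real_rowCell (hσ : 0 < rowStdDev a n) (k : ℕ) :
    volume.real (rowCell a n k) = 1 / rowStdDev a n := by
  have : (k - rowMean a n) / rowStdDev a n ≤ (k + 1 - rowMean a n) / rowStdDev a n := by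
    gcongr; linarith
  rw [rowCell, Real.volume_real_Ico_of_le this]
  ring

lemma rowDensity_eq_sum_indicator (hσ : 0 < rowStdDev a n) :
    rowDensity a n = fun x => ∑ k ∈ Finset.range (n + 1),
      (rowCell a n k).indicator (fun _ => rowStdDev a n * normProb a n k) x := by
  funext x
  set m := ⌊rowMean a n + x * rowStdDev a n⌋ with hm
  have hind : ∀ k : ℕ, (rowCell a n k).indicator
      (fun _ => rowStdDev a n * normProb a n k) x =
      if m = (k : ℤ) then rowStdDev a n * normProb a n k else 0 := by
    intro k
    classical
    rw [Set.indicator_apply]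
    exact if_congr (mem_rowCell hσ) rfl rfl
  simp only [hind, rowDensity, ← hm]
  by_cases h : 0 ≤ m ∧ m ≤ n
  · rw [Finset.sum_eq_single m.toNat]
    · rw [if_pos (by omega), Int.toNat_of_nonneg h.1]
    · intro k _ hk
      rw [if_neg (by omega)]
    · intro hk
      exact absurd (Finset.mem_range.2 (by omega)) hk
  · rw [Finset.sum_eq_zero, normProb, if_neg h, mul_zero]
    intro k hk
    have := Finset.mem_range.1 hk
    rw [if_neg (by omega)]

lemma integrable_indicator_rowCell (k : ℕ) (v : ℝ) :
    Integrable ((rowCell a n k).indicator fun _ => v) :=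
  (integrable_indicator_iff measurableSet_Ico).2 (by
    refine integrableOn_const (measure_Ico_lt_top).ne)

lemma integrable_rowDensity (hσ : 0 < rowStdDev a n) : Integrable (rowDensity a n) := by
  rw [rowDensity_eq_sum_indicator hσ]
  exact integrable_finsetSum _ fun k _ => integrable_indicator_rowCell k _

lemma setIntegral_rowDensity (hσ : 0 < rowStdDev a n) (S : Set ℝ) :
    ∫ x in S, rowDensity a n x = ∑ k ∈ Finset.range (n + 1),
      normProb a n k * (rowStdDev a n * volume.real (rowCell a n k ∩ S)) := by
  rw [rowDensity_eq_sum_indicator hσ, integral_finsetSum _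
    fun k _ => (integrable_indicator_rowCell k _).integrableOn]
  refine Finset.sum_congr rfl fun k _ => ?_
  have hm : MeasurableSet (rowCell a n k) := measurableSet_Ico
  rw [integral_indicator_const _ hm, measureReal_restrict_apply hm, smul_eq_mul]
  ring

lemma integral_rowDensity (hσ : 0 < rowStdDev a n)
    (h1 : ∑ k ∈ Finset.range (n + 1), normProb a n k = 1) : ∫ x, rowDensity a n x = 1 := by
  rw [← setIntegral_univ, setIntegral_rowDensity hσ, ← h1]
  refine Finset.sum_congr rfl fun k _ => ?_
  rw [Set.inter_univ, volume_real_rowCell hσ, mul_one_div_cancel hσ.ne', mul_one]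

/-- Spreading out the atoms changes the distribution function by at most one atom. -/
lemma abs_sum_filter_sub_setIntegral_rowDensity_le (hσ : 0 < rowStdDev a n)
    (hnn : ∀ k : ℤ, 0 ≤ normProb a n k) (x : ℝ)
    [DecidablePred fun k : ℕ => (k : ℝ) ≤ rowMean a n + x * rowStdDev a n] :
    |(∑ k ∈ (Finset.range (n + 1)).filter
        (fun k : ℕ => (k : ℝ) ≤ rowMean a n + x * rowStdDev a n), normProb a n k) -
      ∫ t in Set.Iic x, rowDensity a n t| ≤
      normProb a n ⌊rowMean a n + x * rowStdDev a n⌋ := by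
  set m := ⌊rowMean a n + x * rowStdDev a n⌋ with hm
  rw [setIntegral_rowDensity hσ, Finset.sum_filter, ← Finset.sum_sub_distrib]
  refine (Finset.abs_sum_le_sum_abs _ _).trans ?_
  -- Only the cell that contains `x` contributes: all earlier ones lie in `Iic x`, all later ones
  -- outside it.
  have hterm : ∀ k : ℕ,
      |(if (k : ℝ) ≤ rowMean a n + x * rowStdDev a n then normProb a n k else 0) -
      normProb a n k * (rowStdDev a n * volume.real (rowCell a n k ∩ Set.Iic x))| ≤
      if (k : ℤ) = m then normProb a n k else 0 := by
    intro k
    have hle : volume.real (rowCell a n k ∩ Set.Iic x) ≤ 1 / rowStdDev a n := by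
      rw [← volume_real_rowCell hσ k]
      exact measureReal_mono Set.inter_subset_left (measure_Ico_lt_top).ne
    have h0 : 0 ≤ rowStdDev a n * volume.real (rowCell a n k ∩ Set.Iic x) := by positivity
    have hle' : rowStdDev a n * volume.real (rowCell a n k ∩ Set.Iic x) ≤ 1 := by
      rw [le_div_iff₀ hσ] at hle; linarith
    have hk := hnn k
    rcases lt_trichotomy (k : ℤ) m with h | h | h
    · have h2 : (k : ℝ) + 1 ≤ rowMean a n + x * rowStdDev a n := by
        have := Int.le_floor.1 (Int.add_one_le_iff.2 h)
        exact_mod_cast this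
      have hsub : rowCell a n k ⊆ Set.Iic x := by
        intro y hy
        refine hy.2.le.trans ?_
        rw [div_le_iff₀ hσ]; linarith
      rw [Set.inter_eq_left.2 hsub, volume_real_rowCell hσ, mul_one_div_cancel hσ.ne', mul_one,
        if_pos (by linarith), sub_self, abs_zero]
      split_ifs <;> simp [hk]
    · have h2 : (k : ℝ) ≤ rowMean a n + x * rowStdDev a n := by
        have := Int.le_floor.1 h.le
        exact_mod_cast this
      rw [if_pos h2, if_pos h, abs_le]
      constructor <;> nlinarith
    · have h2 : rowMean a n + x * rowStdDev a n < k := by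
        have := Int.floor_lt.1 h
        exact_mod_cast this
      have hempty : rowCell a n k ∩ Set.Iic x = ∅ := by
        refine Set.eq_empty_of_forall_notMem fun y ⟨hy, hyx⟩ => ?_
        have h3 := hy.1
        rw [div_le_iff₀ hσ] at h3
        have h4 : y * rowStdDev a n ≤ x * rowStdDev a n :=
          mul_le_mul_of_nonneg_right hyx hσ.le
        linarith
      rw [hempty, if_neg h2.not_ge, if_neg h.ne']
      simp
  refine (Finset.sum_le_sum fun k _ => hterm k).trans ?_
  by_cases h : 0 ≤ m
  · have e : ∀ k : ℕ, ((k : ℤ) = m) = (k = m.toNat) := fun k => by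
      rw [eq_iff_iff]; omega
    simp only [e]
    rw [Finset.sum_ite_eq', Int.toNat_of_nonneg h]
    split_ifs
    exacts [le_rfl, hnn m]
  · rw [Finset.sum_eq_zero fun k _ => if_neg (by omega)]
    exact hnn m

end Density

lemma integrable_gaussian_density :
    Integrable fun x : ℝ => 1 / √(2 * Real.pi) * Real.exp (-x ^ 2 / 2) := by
  have := (integrable_exp_neg_mul_sq (b := 1 / 2) (by norm_num)).const_mul (1 / √(2 * Real.pi))
  refine this.congr (ae_of_all _ fun x => ?_)
  simp only
  congr 2; ring

lemma integral_gaussian_density :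
    ∫ x : ℝ, 1 / √(2 * Real.pi) * Real.exp (-x ^ 2 / 2) = 1 := by
  have h := integral_gaussian (1 / 2)
  have e : ∀ x : ℝ, -x ^ 2 / 2 = -(1 / 2) * x ^ 2 := fun x => by ring
  simp only [e]
  rw [integral_const_mul, h, show Real.pi / (1 / 2) = 2 * Real.pi by ring]
  have : √(2 * Real.pi) ≠ 0 := by positivity
  field_simp

/-- Scheffé's lemma: nonnegative densities that converge pointwise to a probability density
converge in `L¹`. -/
lemma tendsto_integral_abs_sub_of_tendsto {α : Type*} [MeasurableSpace α] {μ : Measure α}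
    {f : ℕ → α → ℝ} {g : α → ℝ} (hf : ∀ᶠ n in atTop, Integrable (f n) μ) (hg : Integrable g μ)
    (hf0 : ∀ᶠ n in atTop, ∀ x, 0 ≤ f n x) (hg0 : ∀ x, 0 ≤ g x)
    (hint : ∀ᶠ n in atTop, ∫ x, f n x ∂μ = ∫ x, g x ∂μ)
    (hlim : ∀ x, Tendsto (fun n => f n x) atTop (𝓝 (g x))) :
    Tendsto (fun n => ∫ x, |f n x - g x| ∂μ) atTop (𝓝 0) := by
  have h1 : Tendsto (fun n => ∫ x, max (g x - f n x) 0 ∂μ) atTop (𝓝 0) := by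
    have h0 : (0 : ℝ) = ∫ _ : α, (0 : ℝ) ∂μ := by simp
    conv => rhs; rw [h0]
    refine tendsto_integral_filter_of_dominated_convergence g ?_ ?_ hg (ae_of_all _ fun x => ?_)
    · filter_upwards [hf] with n hn
      exact (hg.sub hn).pos_part.aestronglyMeasurable
    · filter_upwards [hf0] with n hn
      refine ae_of_all _ fun x => ?_
      rw [Real.norm_eq_abs, abs_of_nonneg (le_max_right _ _)]
      exact max_le (by linarith [hn x]) (hg0 x)
    · have := ((hlim x).const_sub (g x)).max (tendsto_const_nhds (x := (0 : ℝ)))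
      simpa using this
  have h2 := h1.const_mul 2
  rw [mul_zero] at h2
  refine h2.congr' ?_
  filter_upwards [hf, hint] with n hn hi
  have e : ∀ x, |f n x - g x| = 2 * max (g x - f n x) 0 + (f n x - g x) := by
    intro x
    rcases le_total (f n x) (g x) with h | h
    · rw [abs_of_nonpos (by linarith), max_eq_left (by linarith)]; ring
    · rw [abs_of_nonneg (by linarith), max_eq_right (by linarith)]; ring
  simp only [e]
  have hp : Integrable (fun x => max (g x - f n x) 0) μ := (hg.sub hn).pos_part
  have hd : Integrable (fun x => f n x - g x) μ := hn.sub hg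
  rw [integral_add (hp.const_mul 2) hd, integral_const_mul,
    integral_sub hn hg, hi, sub_self, add_zero]

/-- A local limit theorem with `σ_n → ∞` gives a central limit theorem. -/
lemma AsympNormalLLT.asympNormalCLT {a : ℕ → ℕ → ℝ} (h : AsympNormalLLT a)
    (hσ : Tendsto (rowStdDev a) atTop atTop) (hnn : ∀ n (k : ℤ), 0 ≤ normProb a n k)
    (hsum : ∀ n, ∑ k ∈ Finset.range (n + 1), normProb a n k = 1) : AsympNormalCLT a := by
  have hL := tendsto_iSup_ofReal_zero_iff.1 h
  have hpos := hσ.eventually_gt_atTop 0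
  have hS := tendsto_integral_abs_sub_of_tendsto
    (f := rowDensity a) (g := fun x => 1 / √(2 * Real.pi) * Real.exp (-x ^ 2 / 2))
    (hpos.mono fun n hn => integrable_rowDensity hn) integrable_gaussian_density
    (Eventually.of_forall fun n x => mul_nonneg (Real.sqrt_nonneg _) (hnn _ _))
    (fun x => by positivity)
    (hpos.mono fun n hn => by rw [integral_rowDensity hn (hsum n), integral_gaussian_density])
    (fun x => by
      rw [Metric.tendsto_atTop']
      intro ε hε
      obtain ⟨N, hN⟩ := eventually_atTop.1 (hL (ε / 2) (by positivity))
      exact ⟨N, fun n hn => (hN n hn.le x).trans_lt (by linarith)⟩)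
  refine tendsto_iSup_ofReal_zero_iff.2 fun ε hε => ?_
  have h1 := (hσ.const_div_atTop 2).add hS
  rw [add_zero] at h1
  filter_upwards [h1.eventually_le_const hε, hpos, hL 1 one_pos] with n hn hn0 hn1 x
  refine le_trans ?_ hn
  rw [← integral_const_mul]
  refine (abs_sub_le _ (∫ t in Set.Iic x, rowDensity a n t) _).trans (add_le_add
    ((abs_sum_filter_sub_setIntegral_rowDensity_le hn0 (hnn n) x).trans ?_) ?_)
  · -- The atom `p` satisfies `σ p ≤ 2`, as `σ p` is within `1` of a density value at most `1`.
    rw [le_div_iff₀ hn0]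
    have h2 := (abs_le.1 (hn1 x)).2
    have h3 : 1 / √(2 * Real.pi) * Real.exp (-x ^ 2 / 2) ≤ 1 := by
      refine mul_le_one₀ ?_ (Real.exp_pos _).le
        (Real.exp_le_one_iff.2 (by nlinarith [sq_nonneg x]))
      rw [div_le_one (by positivity)]
      exact Real.one_le_sqrt.2 (by linarith [Real.pi_gt_three])
    linarith
  · rw [← integral_sub (integrable_rowDensity hn0).integrableOn
      integrable_gaussian_density.integrableOn]
    refine (abs_integral_le_integral_abs).trans (setIntegral_le_integral ?_ ?_)
    · exact ((integrable_rowDensity hn0).sub integrable_gaussian_density).abs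
    · exact ae_of_all _ fun x => abs_nonneg _

/-! ### Recurrences for the coordination triangle -/

lemma finite_latticeSphere (n k : ℕ) : {x : Fin k → ℤ | ∑ i, |x i| = (n : ℤ)}.Finite := by
  refine (Set.finite_Icc (fun _ => -(n : ℤ)) (fun _ => (n : ℤ))).subset fun x hx => ?_
  have h : ∀ i, |x i| ≤ n := fun i =>
    (Finset.single_le_sum (f := fun i => |x i|) (fun i _ => abs_nonneg _)
      (Finset.mem_univ i)).trans_eq hx
  exact ⟨fun i => (abs_le.1 (h i)).1, fun i => (abs_le.1 (h i)).2⟩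

lemma latticeCoord_zero_left (k : ℕ) : latticeCoord 0 k = 1 := by
  rw [latticeCoord, Set.ncard_eq_one]
  refine ⟨0, Set.ext fun x => ?_⟩
  simp only [Set.mem_ofPred_eq, Nat.cast_zero, Set.mem_singleton_iff]
  rw [Finset.sum_eq_zero_iff_of_nonneg fun _ _ => abs_nonneg _]
  simp [funext_iff]

lemma latticeCoord_succ_zero (n : ℕ) : latticeCoord (n + 1) 0 = 0 := by
  have : {x : Fin 0 → ℤ | ∑ i, |x i| = ((n + 1 : ℕ) : ℤ)} = ∅ := by
    ext x
    simp only [Finset.univ_eq_empty, Finset.sum_empty, Set.mem_ofPred_eq, Set.mem_empty_iff_false,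
      iff_false]
    omega
  rw [latticeCoord, this, Set.ncard_empty]

/-- Points of the sphere of radius `n + 1` with vanishing first coordinate come from the sphere in
one dimension less; the others arise by moving the first coordinate of a point of the sphere of
radius `n` away from the origin, in two ways when it vanishes. -/
lemma latticeCoord_succ_succ (n k : ℕ) :
    latticeCoord (n + 1) (k + 1) =
      latticeCoord n (k + 1) + latticeCoord (n + 1) k + latticeCoord n k := by
  let sph : ℕ → Set (Fin (k + 1) → ℤ) := fun m => {x | ∑ i, |x i| = (m : ℤ)}
  have hfin : ∀ m, (sph m).Finite := fun m => finite_latticeSphere m _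
  let up : (Fin (k + 1) → ℤ) → (Fin (k + 1) → ℤ) := fun x => Fin.cons (x 0 + 1) (Fin.tail x)
  let dn : (Fin (k + 1) → ℤ) → (Fin (k + 1) → ℤ) := fun x => Fin.cons (x 0 - 1) (Fin.tail x)
  have hup : Function.LeftInverse dn up := fun x => by simp [up, dn]
  have hdn : Function.LeftInverse up dn := fun x => by simp [up, dn]
  have hmem : ∀ m x, x ∈ sph m ↔ |x 0| + ∑ i, |Fin.tail x i| = (m : ℤ) := fun m x => by
    simp only [sph, Set.mem_ofPred_eq, Fin.sum_univ_succ, Fin.tail]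
  have hzero : ∀ m, {x | x ∈ sph m ∧ x 0 = 0}.ncard = latticeCoord m k := by
    intro m
    rw [latticeCoord, ← Set.ncard_image_of_injective {x : Fin k → ℤ | ∑ i, |x i| = (m : ℤ)}
      (Fin.cons_right_injective (α := fun _ => ℤ) (0 : ℤ))]
    refine congrArg Set.ncard (Set.ext fun x => ?_)
    simp only [Set.mem_ofPred_eq, hmem, Set.mem_image]
    constructor
    · rintro ⟨h1, h2⟩
      refine ⟨Fin.tail x, by simpa [h2] using h1, ?_⟩
      rw [← h2, Fin.cons_self_tail]
    · rintro ⟨y, hy, rfl⟩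
      simpa using hy
  have hpos : {x | x ∈ sph (n + 1) ∧ 0 < x 0} = up '' {x | x ∈ sph n ∧ 0 ≤ x 0} := by
    rw [Set.image_eq_preimage_of_inverse hup hdn]
    ext x
    simp only [Set.mem_preimage, Set.mem_ofPred_eq, hmem, dn, Fin.cons_zero, Fin.tail_cons]
    push_cast
    constructor <;> rintro ⟨h1, h2⟩
    · rw [abs_of_pos h2] at h1
      rw [abs_of_nonneg (by omega)]
      omega
    · rw [abs_of_nonneg h2] at h1
      rw [abs_of_pos (by omega)]
      omega
  have hneg : {x | x ∈ sph (n + 1) ∧ x 0 < 0} = dn '' {x | x ∈ sph n ∧ x 0 ≤ 0} := by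
    rw [Set.image_eq_preimage_of_inverse hdn hup]
    ext x
    simp only [Set.mem_preimage, Set.mem_ofPred_eq, hmem, up, Fin.cons_zero, Fin.tail_cons]
    push_cast
    constructor <;> rintro ⟨h1, h2⟩
    · rw [abs_of_neg h2] at h1
      rw [abs_of_nonpos (by omega)]
      omega
    · rw [abs_of_nonpos h2] at h1
      rw [abs_of_neg (by omega)]
      omega
  have hsplit : sph (n + 1) = {x | x ∈ sph (n + 1) ∧ x 0 = 0} ∪
      ({x | x ∈ sph (n + 1) ∧ 0 < x 0} ∪ {x | x ∈ sph (n + 1) ∧ x 0 < 0}) := by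
    ext x
    simp only [Set.mem_union, Set.mem_ofPred_eq]
    have := lt_trichotomy (x 0) 0
    tauto
  have hunion : sph n = {x | x ∈ sph n ∧ 0 ≤ x 0} ∪ {x | x ∈ sph n ∧ x 0 ≤ 0} := by
    ext x
    simp only [Set.mem_union, Set.mem_ofPred_eq, ← and_or_left, le_total, and_true]
  have hinter : {x | x ∈ sph n ∧ x 0 = 0} =
      {x | x ∈ sph n ∧ 0 ≤ x 0} ∩ {x | x ∈ sph n ∧ x 0 ≤ 0} := by
    ext x
    simp only [Set.mem_inter_iff, Set.mem_ofPred_eq, le_antisymm_iff]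
    tauto
  have hsub : ∀ m (P : (Fin (k + 1) → ℤ) → Prop), {x | x ∈ sph m ∧ P x}.Finite :=
    fun m P => (hfin m).subset fun _ h => h.1
  have hcard : (sph (n + 1)).ncard = latticeCoord (n + 1) k +
      ({x | x ∈ sph n ∧ 0 ≤ x 0}.ncard + {x | x ∈ sph n ∧ x 0 ≤ 0}.ncard) := by
    rw [hsplit, Set.ncard_union_eq _ (hsub _ _) ((hsub _ _).union (hsub _ _)),
      Set.ncard_union_eq _ (hsub _ _) (hsub _ _), hzero, hpos, hneg,
      Set.ncard_image_of_injective _ hup.injective, Set.ncard_image_of_injective _ hdn.injective]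
    · rw [Set.disjoint_left]
      rintro x ⟨_, h1⟩ ⟨_, h2⟩
      omega
    · rw [Set.disjoint_left]
      rintro x ⟨_, h1⟩ (⟨_, h2⟩ | ⟨_, h2⟩) <;> omega
  have hcard' := Set.ncard_union_add_ncard_inter {x | x ∈ sph n ∧ 0 ≤ x 0}
    {x | x ∈ sph n ∧ x 0 ≤ 0} (hsub _ _) (hsub _ _)
  rw [← hunion, ← hinter, hzero] at hcard'
  change (sph (n + 1)).ncard = (sph n).ncard + _ + _
  omega

lemma coordTriangle_self (n : ℕ) : coordTriangle n n = 1 := by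
  rw [coordTriangle, if_pos le_rfl, Nat.sub_self, latticeCoord_zero_left]

lemma coordTriangle_one_zero : coordTriangle 1 0 = 2 := by
  rw [coordTriangle, if_pos zero_le_one, latticeCoord_succ_succ, latticeCoord_zero_left,
    latticeCoord_zero_left, latticeCoord_succ_zero]

lemma coordTriangle_succ_succ_zero (n : ℕ) :
    coordTriangle (n + 2) 0 = coordTriangle (n + 1) 0 := by
  rw [coordTriangle, coordTriangle, if_pos (Nat.zero_le _), if_pos (Nat.zero_le _), Nat.sub_zero,
    Nat.sub_zero, latticeCoord_succ_succ, latticeCoord_succ_zero, latticeCoord_succ_zero,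
    add_zero, add_zero]

lemma coordTriangle_succ_succ_succ (n k : ℕ) : coordTriangle (n + 2) (k + 1) =
    coordTriangle (n + 1) (k + 1) + coordTriangle (n + 1) k + coordTriangle n k := by
  rcases lt_trichotomy k (n + 1) with h | rfl | h
  · obtain ⟨m, rfl⟩ := Nat.exists_eq_add_of_le (Nat.lt_succ_iff.1 h)
    simp only [coordTriangle]
    rw [if_pos (by omega), if_pos (by omega), if_pos (by omega), if_pos (by omega),
      show k + m + 2 - (k + 1) = m + 1 by omega, show k + m + 1 - (k + 1) = m by omega,
      show k + m + 1 - k = m + 1 by omega, show k + m - k = m by omega]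
    exact latticeCoord_succ_succ m (k + 1)
  · rw [coordTriangle_self, coordTriangle_self]
    simp [coordTriangle]
  · simp only [coordTriangle]
    rw [if_neg (by omega), if_neg (by omega), if_neg (by omega), if_neg (by omega)]

/-- The row polynomials of the coordination triangle. -/
noncomputable abbrev coordPoly (n : ℕ) : Polynomial ℝ :=
  rowPoly (fun n k => (coordTriangle n k : ℝ)) n

lemma coordPoly_coeff (n k : ℕ) : (coordPoly n).coeff k = coordTriangle n k := by
  rw [rowPoly_coeff]
  split_ifs with h
  · rfl
  · rw [coordTriangle, if_neg h, Nat.cast_zero]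

lemma coordPoly_zero : coordPoly 0 = 1 := by
  simp [coordPoly, rowPoly, coordTriangle_self]

lemma coordPoly_one : coordPoly 1 = Polynomial.C 2 + Polynomial.X := by
  simp [coordPoly, rowPoly, Finset.sum_range_succ, coordTriangle_self, coordTriangle_one_zero,
    Polynomial.C_ofNat]

lemma coordPoly_add_two (n : ℕ) : coordPoly (n + 2) =
    (1 + Polynomial.X) * coordPoly (n + 1) + Polynomial.X * coordPoly n := by
  ext k
  cases k with
  | zero =>
    simp only [add_mul, one_mul, Polynomial.coeff_add, Polynomial.coeff_X_mul_zero,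
      coordPoly_coeff, coordTriangle_succ_succ_zero, add_zero]
  | succ k =>
    simp only [add_mul, one_mul, Polynomial.coeff_add, Polynomial.coeff_X_mul,
      coordPoly_coeff, coordTriangle_succ_succ_succ, Nat.cast_add]

/-! ### Zeros of the row polynomials of the coordination triangle -/

/-- The positive solution `y` of `1 - y² = 2 y cos θ`. -/
noncomputable def charRadius (θ : ℝ) : ℝ := √(Real.cos θ ^ 2 + 1) - Real.cos θ

lemma charRadius_pos (θ : ℝ) : 0 < charRadius θ := by
  rw [charRadius, sub_pos]
  exact Real.lt_sqrt_of_sq_lt (by linarith)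

lemma one_sub_charRadius_sq (θ : ℝ) :
    1 - charRadius θ ^ 2 = 2 * charRadius θ * Real.cos θ := by
  have h := Real.sq_sqrt (by positivity : 0 ≤ Real.cos θ ^ 2 + 1)
  rw [charRadius]
  linear_combination -h

lemma charRadius_strictMonoOn : StrictMonoOn charRadius (Set.Icc 0 Real.pi) := by
  intro x hx y hy hxy
  have hcos := Real.strictAntiOn_cos hx hy hxy
  have h1 := one_sub_charRadius_sq x
  have h2 := one_sub_charRadius_sq y
  have px := charRadius_pos x
  have py := charRadius_pos y
  -- `cos θ = (1 / y - y) / 2` decreases in `y`.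
  by_contra! hle
  have : charRadius y * Real.cos y < charRadius x * Real.cos x := by
    have e1 : 2 * Real.cos x = 1 / charRadius x - charRadius x := by
      field_simp; linarith
    have e2 : 2 * Real.cos y = 1 / charRadius y - charRadius y := by
      field_simp; linarith
    have := one_div_le_one_div_of_le py hle
    linarith
  nlinarith

/-- On the negative axis the recurrence for the row polynomials has constant coefficients and
characteristic roots `y exp (± i θ)`, which gives a trigonometric closed form. -/
lemma coordPoly_eval_neg_sq {y θ : ℝ} (h : 1 - y ^ 2 = 2 * y * Real.cos θ) (n : ℕ) :
    Real.sin θ * (y * (coordPoly n).eval (-y ^ 2)) =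
      y ^ n * (y * Real.sin ((n + 1) * θ) + Real.sin (n * θ)) := by
  induction n using Nat.twoStepInduction with
  | zero => simp [coordPoly_zero]; ring
  | one =>
    have h2 : ((1 : ℕ) + 1 : ℝ) * θ = 2 * θ := by push_cast; ring
    rw [coordPoly_one, h2, Real.sin_two_mul]
    simp only [Polynomial.eval_add, Polynomial.eval_C, Polynomial.eval_X, Nat.cast_one, one_mul,
      pow_one]
    linear_combination Real.sin θ * y * h
  | more n ih1 ih2 =>
    have hsin : ∀ x : ℝ, Real.sin (x + 2 * θ) =
        2 * Real.cos θ * Real.sin (x + θ) - Real.sin x := by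
      intro x
      have e1 : x + 2 * θ = (x + θ) + θ := by ring
      have e2 : Real.sin x = Real.sin ((x + θ) - θ) := by congr 1; ring
      rw [e1, e2, Real.sin_add (x + θ) θ, Real.sin_sub (x + θ) θ]; ring
    have r1 := hsin (n * θ)
    have r2 := hsin ((n + 1) * θ)
    push_cast at ih1 ih2 ⊢
    rw [show (n + 2 + 1 : ℝ) * θ = (n + 1) * θ + 2 * θ by ring,
      show (n + 2 : ℝ) * θ = n * θ + 2 * θ by ring, r1, r2]
    rw [show (n + 1 + 1 : ℝ) * θ = (n + 1) * θ + θ by ring,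
      show (n + 1 : ℝ) * θ = n * θ + θ by ring] at ih2
    rw [show (n + 1 : ℝ) * θ = n * θ + θ by ring] at ih1 ⊢
    rw [coordPoly_add_two]
    simp only [Polynomial.eval_add, Polynomial.eval_mul, Polynomial.eval_one, Polynomial.eval_X]
    rw [← sub_eq_add_neg, h]
    linear_combination (2 * y * Real.cos θ) * ih2 - y ^ 2 * ih1

/-- The case `θ = π` of a double characteristic root. -/
lemma coordPoly_eval_neg_sq_of_double {y : ℝ} (h : 1 - y ^ 2 = -(2 * y)) (n : ℕ) :
    y * (coordPoly n).eval (-y ^ 2) = (-y) ^ n * (y * (n + 1) - n) := by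
  induction n using Nat.twoStepInduction with
  | zero => simp [coordPoly_zero]
  | one =>
    simp only [coordPoly_one, Polynomial.eval_add, Polynomial.eval_C, Polynomial.eval_X]
    push_cast
    linear_combination y * h
  | more n ih1 ih2 =>
    rw [coordPoly_add_two]
    simp only [Polynomial.eval_add, Polynomial.eval_mul, Polynomial.eval_one, Polynomial.eval_X]
    rw [← sub_eq_add_neg, h]
    push_cast at ih2 ⊢
    linear_combination (-(2 * y)) * ih2 - y ^ 2 * ih1

/-- The points `-y²` that belong to the angles `θ = j π / (n + 1)`. The `n`-th row polynomial
alternates in sign at those with `1 ≤ j ≤ n + 1`; the one with `j = 0` is an upper bound for its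
zeros. -/
noncomputable def signNode (n j : ℕ) : ℝ := -charRadius (j * Real.pi / (n + 1)) ^ 2

lemma signNode_lt {n i j : ℕ} (hij : i < j) (hj : j ≤ n + 1) : signNode n j < signNode n i := by
  have hpi := Real.pi_pos
  have hmem : ∀ k : ℕ, k ≤ n + 1 → (k * Real.pi / (n + 1) : ℝ) ∈ Set.Icc 0 Real.pi := by
    intro k hk
    refine ⟨by positivity, ?_⟩
    rw [div_le_iff₀ (by positivity), mul_comm]
    gcongr
    exact_mod_cast hk
  have h := charRadius_strictMonoOn (hmem i (by omega)) (hmem j hj) (by gcongr)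
  rw [signNode, signNode, neg_lt_neg_iff]
  exact pow_lt_pow_left₀ h (charRadius_pos _).le two_ne_zero

/-- At the angle `j π / (n + 1)` with `j ≤ n` the summand `sin ((n + 1) θ)` of the closed form
vanishes and `sin (n θ)` has the sign `(-1)^(j + 1)`; for `j = n + 1` the closed form degenerates
and is replaced by that for a double characteristic root. -/
lemma coordPoly_eval_signNode_pos {n j : ℕ} (hj : 1 ≤ j) (hjn : j ≤ n + 1) :
    0 < (-1) ^ (j + 1) * (coordPoly n).eval (signNode n j) := by
  have hpi := Real.pi_pos
  have hn : (0 : ℝ) < n + 1 := by positivity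
  set θ : ℝ := j * Real.pi / (n + 1) with hθ
  have hy := charRadius_pos θ
  have hyθ := one_sub_charRadius_sq θ
  rw [signNode, ← hθ]
  set y := charRadius θ
  refine pos_of_mul_pos_right (a := y) ?_ hy.le
  rw [mul_left_comm]
  rcases hjn.lt_or_eq with hlt | rfl
  · have hj0 : (0 : ℝ) < j := by exact_mod_cast hj
    have hsin : 0 < Real.sin θ := by
      refine Real.sin_pos_of_pos_of_lt_pi (by positivity) ?_
      rw [hθ, div_lt_iff₀ hn, mul_comm]
      gcongr
      exact_mod_cast hlt
    have h := coordPoly_eval_neg_sq hyθ n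
    have h1 : (n + 1 : ℝ) * θ = j * Real.pi := by rw [hθ]; field_simp
    have h2 : (n : ℝ) * θ = j * Real.pi - θ := by linear_combination h1
    rw [h1, h2, Real.sin_nat_mul_pi, Real.sin_nat_mul_pi_sub, mul_zero, zero_add] at h
    have h3 : y * (coordPoly n).eval (-y ^ 2) = y ^ n * -(-1) ^ j := by
      refine mul_left_cancel₀ hsin.ne' ?_
      linear_combination h
    rw [h3]
    have : (-1 : ℝ) ^ (j + 1) * (y ^ n * -(-1) ^ j) = y ^ n * ((-1) ^ j * (-1) ^ j) := by ring
    rw [this, ← mul_pow]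
    simpa using pow_pos hy n
  · have hθpi : θ = Real.pi := by rw [hθ]; push_cast; field_simp
    rw [hθpi, Real.cos_pi] at hyθ
    rw [coordPoly_eval_neg_sq_of_double (by linarith) n]
    have hy1 : 1 < y := by nlinarith
    have h4 : 0 < y * (n + 1) - n := by nlinarith
    have : (-1 : ℝ) ^ (n + 1 + 1) * ((-y) ^ n * (y * (n + 1) - n)) =
        ((-1) * (-y)) ^ n * (y * (n + 1) - n) := by rw [mul_pow]; ring
    rw [this, neg_one_mul, neg_neg]
    positivity

lemma Polynomial.exists_isRoot_Ioo {P : Polynomial ℝ} {u v : ℝ} (huv : u < v)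
    (h : P.eval u * P.eval v < 0) : ∃ x ∈ Set.Ioo u v, P.IsRoot x := by
  have hc : ContinuousOn (fun x => P.eval x) (Set.Icc u v) := P.continuous.continuousOn
  rcases mul_neg_iff.1 h with ⟨h1, h2⟩ | ⟨h1, h2⟩
  · exact intermediate_value_Ioo' huv.le hc ⟨h2, h1⟩
  · exact intermediate_value_Ioo huv.le hc ⟨h1, h2⟩

/-- Each gap between consecutive sign nodes contains a zero. -/
lemma coordPoly_exists_roots (n : ℕ) : ∃ f : Fin n → ℝ, Function.Injective f ∧
    ∀ i, (coordPoly n).IsRoot (f i) ∧ f i ∈ Set.Ioo (signNode n (n + 1)) (signNode n 0) := by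
  have hex : ∀ i : Fin n, ∃ x ∈ Set.Ioo (signNode n (i + 2)) (signNode n (i + 1)),
      (coordPoly n).IsRoot x := by
    intro i
    have hi := i.2
    refine Polynomial.exists_isRoot_Ioo (signNode_lt (by omega) (by omega)) ?_
    have h1 := coordPoly_eval_signNode_pos (n := n) (j := i + 1) (by omega) (by omega)
    have h2 := coordPoly_eval_signNode_pos (n := n) (j := i + 2) (by omega) (by omega)
    have h3 := mul_pos h1 h2
    have e : ((-1 : ℝ) ^ (i + 1 + 1 : ℕ) * (coordPoly n).eval (signNode n (i + 1))) *
        ((-1) ^ (i + 2 + 1 : ℕ) * (coordPoly n).eval (signNode n (i + 2))) =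
        -(((-1) * (-1)) ^ (i : ℕ) * ((coordPoly n).eval (signNode n (i + 2)) *
          (coordPoly n).eval (signNode n (i + 1)))) := by rw [mul_pow]; ring
    rw [e] at h3
    simpa using h3
  choose f hf hroot using hex
  have hanti : StrictAnti f := by
    intro i j hij
    have hj := j.2
    have hij' : (i : ℕ) < j := hij
    refine (hf j).2.trans_le (le_trans ?_ (hf i).1.le)
    rcases (show (i : ℕ) + 2 ≤ j + 1 by omega).eq_or_lt with h | h
    · rw [h]
    · exact (signNode_lt h (by omega)).le
  refine ⟨f, hanti.injective, fun i => ⟨hroot i, ?_, ?_⟩⟩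
  · have hi := i.2
    refine lt_of_le_of_lt ?_ (hf i).1
    rcases (show (i : ℕ) + 2 ≤ n + 1 by omega).eq_or_lt with h | h
    · rw [h]
    · exact (signNode_lt h le_rfl).le
  · have hi := i.2
    exact (hf i).2.trans (signNode_lt (by omega) (by omega))

/-- A polynomial of degree `n` with `n` distinct real zeros has no further complex zeros. -/
lemma Polynomial.exists_eq_of_aeval_eq_zero {P : Polynomial ℝ} (hP : P ≠ 0) {n : ℕ}
    (hn : P.natDegree = n) {f : Fin n → ℝ} (hf : Function.Injective f)
    (hroot : ∀ i, P.IsRoot (f i)) {z : ℂ} (hz : Polynomial.aeval z P = 0) :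
    ∃ i, z = f i := by
  have hP' : P.map (algebraMap ℝ ℂ) ≠ 0 := by simpa using hP
  have hsub : Finset.univ.image (fun i => (f i : ℂ)) ⊆
      (P.map (algebraMap ℝ ℂ)).roots.toFinset := by
    intro w hw
    obtain ⟨i, -, rfl⟩ := Finset.mem_image.1 hw
    rw [Multiset.mem_toFinset, Polynomial.mem_roots hP']
    exact (hroot i).map (f := algebraMap ℝ ℂ)
  have hcard : (P.map (algebraMap ℝ ℂ)).roots.toFinset.card ≤
      (Finset.univ.image (fun i => (f i : ℂ))).card := by
    have hf' : Function.Injective fun i => (f i : ℂ) := Complex.ofReal_injective.comp hf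
    rw [Finset.card_image_of_injective _ hf', Finset.card_univ,
      Fintype.card_fin]
    refine (Multiset.toFinset_card_le _).trans ((Polynomial.card_roots' _).trans ?_)
    rw [Polynomial.natDegree_map, hn]
  have heq := Finset.eq_of_subset_of_card_le hsub hcard
  have hmem : z ∈ (P.map (algebraMap ℝ ℂ)).roots.toFinset := by
    rw [Multiset.mem_toFinset, Polynomial.mem_roots hP', Polynomial.IsRoot, Polynomial.eval_map]
    exact hz
  rw [← heq] at hmem
  obtain ⟨i, -, hi⟩ := Finset.mem_image.1 hmem
  exact ⟨i, hi.symm⟩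

lemma coordPoly_exists_mem_Ioo {n : ℕ} {z : ℂ} (hz : Polynomial.aeval z (coordPoly n) = 0) :
    ∃ x : ℝ, z = x ∧ x ∈ Set.Ioo (-charRadius Real.pi ^ 2) (-charRadius 0 ^ 2) := by
  have hnn : (coordTriangle n n : ℝ) ≠ 0 := by rw [coordTriangle_self]; norm_num
  obtain ⟨f, hf, hroot⟩ := coordPoly_exists_roots n
  have hP : coordPoly n ≠ 0 := fun h0 =>
    hnn (by rw [← coordPoly_coeff, h0, Polynomial.coeff_zero])
  obtain ⟨i, hi⟩ := Polynomial.exists_eq_of_aeval_eq_zero hP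
    (rowPoly_natDegree (a := fun n k => (coordTriangle n k : ℝ)) hnn) hf
    (fun i => (hroot i).1) hz
  refine ⟨f i, hi, ?_⟩
  have h := (hroot i).2
  have hn : (n + 1 : ℝ) ≠ 0 := by positivity
  simpa [signNode, mul_div_cancel_left₀ _ hn] using h

/-! ### Central and local limit theorems -/

theorem asympNormal_of_roots_mem_Ioo {a : ℕ → ℕ → ℝ} {t₀ t₁ : ℝ} (ht₀ : 0 < t₀) (ht₁ : 0 < t₁)
    (hnn : ∀ n k : ℕ, k ≤ n → 0 ≤ a n k) (hlead : ∀ n : ℕ, a n n ≠ 0)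
    (hreal : ∀ n : ℕ, OnlyRealZeros (rowPoly a n))
    (hroot : ∀ (n : ℕ) (x : ℝ), (rowPoly a n).IsRoot x → x ∈ Set.Ioo (-t₁) (-t₀)) :
    AsympNormalCLT a ∧ AsympNormalLLT a := by
  choose p hp hpb using fun n => exists_isBernoulliSum ht₀ (hlead n) (hreal n) (hroot n)
  have hc : 0 < t₀ / (1 + t₁) ^ 2 := by positivity
  have hpc : ∀ n j, t₀ / (1 + t₁) ^ 2 ≤ p n j * (1 - p n j) := fun n j => (hpb n j).2.2
  have hL : AsympNormalLLT a := asympNormalLLT_of_isBernoulliSum hp hpc hc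
    (fun n j => (hpb n j).1) (fun n j => (hpb n j).2.1)
  refine ⟨hL.asympNormalCLT (tendsto_rowStdDev hp hpc hc) (fun n k => ?_)
    fun n => (hp n).sum_normProb, hL⟩
  rw [normProb]
  split_ifs with h
  · exact div_nonneg (hnn _ _ (by omega))
      (Finset.sum_nonneg fun j hj => hnn _ _ (by have := Finset.mem_range.1 hj; omega))
  · exact le_rfl

theorem mainTheorem6 :
    (∀ (a : ℕ → ℕ → ℝ) (t₀ t₁ : ℝ), 0 < t₀ → 0 < t₁ →
      (∀ n k : ℕ, k ≤ n → 0 ≤ a n k) →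
      (∀ n : ℕ, a n n ≠ 0) →
      (∀ n : ℕ, OnlyRealZeros (rowPoly a n)) →
      (∀ (n : ℕ) (x : ℝ), (rowPoly a n).IsRoot x → x ∈ Set.Ioo (-t₁) (-t₀)) →
      AsympNormalCLT a ∧ AsympNormalLLT a) ∧
    (AsympNormalCLT (fun n k => (coordTriangle n k : ℝ)) ∧
      AsympNormalLLT (fun n k => (coordTriangle n k : ℝ))) := by
  refine ⟨fun a t₀ t₁ ht₀ ht₁ hnn hlead hreal hroot =>
    asympNormal_of_roots_mem_Ioo ht₀ ht₁ hnn hlead hreal hroot, ?_⟩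
  refine asympNormal_of_roots_mem_Ioo (pow_pos (charRadius_pos 0) 2)
    (pow_pos (charRadius_pos Real.pi) 2) (fun n k _ => Nat.cast_nonneg _)
    (fun n => by rw [coordTriangle_self]; norm_num) (fun n z hz => ?_) fun n x hx => ?_
  · obtain ⟨x, rfl, -⟩ := coordPoly_exists_mem_Ioo hz
    exact Complex.ofReal_im x
  · obtain ⟨y, hy, hmem⟩ := coordPoly_exists_mem_Ioo (n := n) (z := (x : ℂ)) (by
      rw [← Complex.coe_algebraMap, Polynomial.aeval_algebraMap_apply,
        Polynomial.coe_aeval_eq_eval, show (coordPoly n).eval x = 0 from hx, map_zero])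
    rwa [Complex.ofReal_injective hy]
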